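/- For a graph $F$ and a finite simple graph $G$, a copy of $F$ in $G$ is a (not necessarily induced) subgraph of $G$ isomorphic to $F$. Let $\nu_F(G)$ be the maximum number of pairwise edge-disjoint copies of $F$ in $G$, and let $\nu^*_F(G)$ be the maximum of $\sum_H w(H)$ over all assignments $w$ of weights in $[0,1]$ to the copies $H$ of $F$ in $G$ such that, for every edge $e$ of $G$, the sum of $w(H)$ over the copies $H$ containing $e$ is at most $1$. Theorem. For every integer $t \ge 3$ there is a constant $c = c(t) > 0$ such that for every integer $n \ge e^{t+1}$ there is an $n$-vertex graph $G$ with $$\nu^*_{K_t}(G) - \nu_{K_t}(G) > \frac{c\, n^2}{(\log n)^{8\sqrt{\log n/\log\log n}}}.$$ In particular (strengthening a lower bound of Yuster, which asserts this only for some $t = t(\varepsilon)$): for every integer $t \ge 3$ and every $\varepsilon > 0$ there is an $N$ such that for every $n > N$ there is an $n$-vertex graph $G$ with $\nu^*_{K_t}(G) - \nu_{K_t}(G) > n^{2-\varepsilon}$. Moreover (answering a question of Yuster negatively), $\nu^*_{K_3}(G) - \nu_{K_3}(G)$ is not $O(n^{3/2})$: there is no constant $C$ such that $\nu^*_{K_3}(G)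 - \nu_{K_3}(G) \le C n^{3/2}$ for all $n$ and all $n$-vertex graphs $G$. -/

import Mathlib

namespace GraphPacking

universe u v

variable {W : Type u} {V : Type v}

/-- The copies of `F` in `G`: the (not necessarily induced) subgraphs of `G` isomorphic to `F`. -/
def copies (F : SimpleGraph W) (G : SimpleGraph V) : Set G.Subgraph :=
  {H | Nonempty (F ≃g H.coe)}

/-- A finite graph contains finitely many copies of any graph. -/
noncomputable instance copiesFintype [Finite V] (F : SimpleGraph W) (G : SimpleGraph V) :
    Fintype (copies F G) :=
  Fintype.ofFinite _

/-- An `F`-packing of `G`: a finite set of pairwise edge-disjoint copies of `F` in `G`. -/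
def IsPacking (F : SimpleGraph W) (G : SimpleGraph V) (P : Finset (copies F G)) : Prop :=
  ∀ H ∈ P, ∀ K ∈ P, H ≠ K → Disjoint H.1.edgeSet K.1.edgeSet

open Classical in
/-- A fractional `F`-packing of `G`: weights in `[0,1]` on the copies of `F` in `G` such that the
total weight of the copies containing any given edge of `G` is at most `1`. -/
def IsFracPacking [Finite V] (F : SimpleGraph W) (G : SimpleGraph V)
    (w : copies F G → ℝ) : Prop :=
  (∀ H, w H ∈ Set.Icc (0 : ℝ) 1) ∧
    ∀ e ∈ G.edgeSet, ∑ H : copies F G with e ∈ H.1.edgeSet, w H ≤ 1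

/-- The `F`-packing number: the maximum number of pairwise edge-disjoint copies of `F` in `G`. -/
noncomputable def packingNumber [Finite V] (F : SimpleGraph W) (G : SimpleGraph V) : ℕ :=
  sSup {k | ∃ P : Finset (copies F G), IsPacking F G P ∧ P.card = k}

/-- The fractional `F`-packing number: the maximum total weight of a fractional `F`-packing. -/
noncomputable def fracPackingNumber [Finite V] (F : SimpleGraph W) (G : SimpleGraph V) : ℝ :=
  sSup {x | ∃ w : copies F G → ℝ, IsFracPacking F G w ∧ ∑ H, w H = x}

/-- The supremum defining the packing number is a maximum. -/
theorem isGreatest_packingNumber [Finite V] (F : SimpleGraph W) (G : SimpleGraph V) :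
    IsGreatest {k | ∃ P : Finset (copies F G), IsPacking F G P ∧ P.card = k}
      (packingNumber F G) := by
  have hb : BddAbove {k | ∃ P : Finset (copies F G), IsPacking F G P ∧ P.card = k} := by
    refine ⟨Fintype.card (copies F G), ?_⟩
    rintro _ ⟨P, -, rfl⟩
    exact Finset.card_le_univ P
  exact ⟨Nat.sSup_mem ⟨0, ∅, by simp [IsPacking], rfl⟩ hb, fun _ hk => le_csSup hb hk⟩

/-- The supremum defining the fractional packing number is a maximum. -/
theorem isGreatest_fracPackingNumber [Finite V] (F : SimpleGraph W) (G : SimpleGraph V) :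
    IsGreatest {x | ∃ w : copies F G → ℝ, IsFracPacking F G w ∧ ∑ H, w H = x}
      (fracPackingNumber F G) := by
  classical
  have hc : IsCompact {w : copies F G → ℝ | IsFracPacking F G w} := by
    refine IsCompact.of_isClosed_subset
      (isCompact_univ_pi fun _ : copies F G => isCompact_Icc (a := (0 : ℝ)) (b := 1)) ?_
      (fun w hw H _ => hw.1 H)
    simp only [IsFracPacking, Set.ofPred_and, Set.ofPred_forall]
    refine (isClosed_iInter fun H => isClosed_Icc.preimage (continuous_apply H)).inter
      (isClosed_iInter fun e => isClosed_iInter fun _ => isClosed_le ?_ continuous_const)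
    exact continuous_finsetSum _ fun H _ => continuous_apply H
  have hK : IsCompact {x | ∃ w : copies F G → ℝ, IsFracPacking F G w ∧ ∑ H, w H = x} :=
    hc.image (f := fun w : copies F G → ℝ => ∑ H, w H)
      (continuous_finsetSum _ fun H _ => continuous_apply H)
  exact hK.isGreatest_sSup ⟨0, 0, by simp [IsFracPacking], by simp⟩

/-- The additive integrality gap `ν*_F(G) - ν_F(G)`. -/
noncomputable def packingGap [Finite V] (F : SimpleGraph W) (G : SimpleGraph V) : ℝ :=
  fracPackingNumber F G - (packingNumber F G : ℝ)

end GraphPacking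

/-! Suppose G is a union of cliques of size t+1 ("blocks"), any two sharing at most one vertex, with
every triangle inside one block. Then every copy of K_t lies in a block. Two copies in the same
block share at least t-1 ≥ 2 vertices, hence an edge, so an integral packing uses each block at most
once. Weight 1/(t-1) on every copy is a fractional packing that collects (t+1)/(t-1) from each
block. The gap is therefore at least 2/(t-1) per block (`IsCliqueSystem.le_packingGap`).

Many blocks come from a Ruzsa–Szemerédi construction. Over t+1 tagged copies of an abelian group Γ,
the blocks are the progressions i ↦ x + i•a with a in A. A triangle gives p•a + q•b = (p+q)•c with
p+q ≤ t, so it stays in one block once A has only trivial solutions. As in Behrend's theorem, strict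
convexity supplies A: the integer points of a box in dimension D, lifted to a paraboloid
(`convexlyIndependent_paraboloid`). Since the lift keeps the whole box, no pigeonholing over spheres
is needed. Balancing D against the side L of the box gives the bound. -/

namespace GraphPacking

universe u v

/-! ### Integrality gap of a union of cliques -/

section CliqueSystems

variable {V : Type v}

/-- A linear system of blocks of size `k` in which every triangle lies in a single block. -/
structure IsCliqueSystem (k : ℕ) (B : Finset (Finset V)) : Prop where
  card_eq : ∀ b ∈ B, b.card = k
  linear : ∀ b ∈ B, ∀ b' ∈ B, ∀ x ∈ b, ∀ y ∈ b, x ∈ b' → y ∈ b' → x ≠ y → b = b'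
  triangle : ∀ x y z, x ≠ y → y ≠ z → x ≠ z → (∃ b ∈ B, x ∈ b ∧ y ∈ b) →
    (∃ b ∈ B, y ∈ b ∧ z ∈ b) → (∃ b ∈ B, x ∈ b ∧ z ∈ b) → ∃ b ∈ B, x ∈ b ∧ y ∈ b ∧ z ∈ b

theorem isCliqueSystem_singleton {s : Finset V} : IsCliqueSystem s.card {s} where
  card_eq := by simp
  linear := by simp
  triangle := by
    intro x y z _ _ _ h1 h2 _
    simp only [Finset.mem_singleton, exists_eq_left] at *
    exact ⟨h1.1, h2⟩

/-- The union of the complete graphs on the blocks of `B`. -/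
def blockGraph (B : Finset (Finset V)) : SimpleGraph V where
  Adj x y := x ≠ y ∧ ∃ b ∈ B, x ∈ b ∧ y ∈ b
  symm := ⟨fun _ _ h => ⟨h.1.symm, h.2.imp fun _ hb => ⟨hb.1, hb.2.2, hb.2.1⟩⟩⟩
  loopless := ⟨fun _ h => h.1 rfl⟩

theorem adj_of_mem_copies {t : ℕ} {G : SimpleGraph V} {H : G.Subgraph}
    (hH : H ∈ copies (SimpleGraph.completeGraph (Fin t)) G) {x y : V}
    (hx : x ∈ H.verts) (hy : y ∈ H.verts) (hxy : x ≠ y) : H.Adj x y := by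
  obtain ⟨e⟩ := hH
  have h : H.coe.Adj (e (e.symm ⟨x, hx⟩)) (e (e.symm ⟨y, hy⟩)) := by
    rw [e.map_adj_iff]
    intro h
    exact hxy (congrArg Subtype.val (e.symm.injective h))
  simpa using h

theorem ncard_verts_of_mem_copies {t : ℕ} {G : SimpleGraph V} {H : G.Subgraph}
    (hH : H ∈ copies (SimpleGraph.completeGraph (Fin t)) G) : H.verts.ncard = t := by
  obtain ⟨e⟩ := hH
  rw [← Nat.card_coe_set_eq, ← Nat.card_congr e.toEquiv, Nat.card_fin]

theorem eq_of_verts_eq {t : ℕ} {G : SimpleGraph V} {H K : G.Subgraph}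
    (hH : H ∈ copies (SimpleGraph.completeGraph (Fin t)) G)
    (hK : K ∈ copies (SimpleGraph.completeGraph (Fin t)) G) (h : H.verts = K.verts) : H = K := by
  refine SimpleGraph.Subgraph.ext h ?_
  ext x y
  constructor
  · intro hxy
    exact adj_of_mem_copies hK (h ▸ H.edge_vert hxy) (h ▸ H.edge_vert hxy.symm) hxy.ne
  · intro hxy
    exact adj_of_mem_copies hH (h ▸ K.edge_vert hxy) (h ▸ K.edge_vert hxy.symm) hxy.ne

theorem induce_mem_copies {t : ℕ} {G : SimpleGraph V} {s : Finset V} (hs : s.card = t)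
    (hc : ∀ x ∈ s, ∀ y ∈ s, x ≠ y → G.Adj x y) :
    (⊤ : G.Subgraph).induce (s : Set V) ∈ copies (SimpleGraph.completeGraph (Fin t)) G := by
  let e : Fin t ≃ s := (s.equivFinOfCardEq hs).symm
  refine ⟨⟨e, ?_⟩⟩
  intro i j
  change (((e i : V) ∈ (s : Set V)) ∧ ((e j : V) ∈ (s : Set V)) ∧ G.Adj (e i) (e j)) ↔ i ≠ j
  constructor
  · rintro ⟨-, -, h⟩ rfl
    exact h.ne rfl
  · intro h
    refine ⟨(e i).2, (e j).2, hc _ (e i).2 _ (e j).2 fun h' => h (e.injective (Subtype.ext h'))⟩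

variable [Fintype V]

open Classical in
/-- The vertex set of a copy, as a finset. -/
noncomputable def copyVerts {W : Type u} {F : SimpleGraph W} {G : SimpleGraph V}
    (H : copies F G) : Finset V :=
  H.1.verts.toFinset

theorem mem_copyVerts {W : Type u} {F : SimpleGraph W} {G : SimpleGraph V} {H : copies F G}
    {x : V} : x ∈ copyVerts H ↔ x ∈ H.1.verts := by
  simp [copyVerts]

theorem card_copyVerts {t : ℕ} {G : SimpleGraph V}
    (H : copies (SimpleGraph.completeGraph (Fin t)) G) : (copyVerts H).card = t := by
  classical
  refine Eq.trans ?_ (ncard_verts_of_mem_copies H.2)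
  rw [Set.ncard_eq_toFinset_card', copyVerts]

theorem copyVerts_injective {t : ℕ} {G : SimpleGraph V} :
    Function.Injective
      (copyVerts : copies (SimpleGraph.completeGraph (Fin t)) G → Finset V) := by
  intro H K h
  refine Subtype.ext (eq_of_verts_eq H.2 K.2 ?_)
  ext x
  rw [← mem_copyVerts, h, mem_copyVerts]

namespace IsCliqueSystem

variable {t : ℕ} {B : Finset (Finset V)}

/-- Any further vertex of the copy spans a triangle with x and y; the block holding that triangle
shares the pair x, y with b, so it is b. -/
theorem copyVerts_subset (hB : IsCliqueSystem (t + 1) B)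
    (H : copies (SimpleGraph.completeGraph (Fin t)) (blockGraph B)) {b : Finset V} (hb : b ∈ B)
    {x y : V} (hxy : x ≠ y) (hx : x ∈ copyVerts H) (hy : y ∈ copyVerts H) (hxb : x ∈ b)
    (hyb : y ∈ b) : copyVerts H ⊆ b := by
  intro z hz
  have adj : ∀ p ∈ copyVerts H, ∀ q ∈ copyVerts H, p ≠ q → (blockGraph B).Adj p q :=
    fun p hp q hq hpq =>
      (adj_of_mem_copies H.2 (mem_copyVerts.1 hp) (mem_copyVerts.1 hq) hpq).adj_sub
  by_cases hxz : x = z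
  · exact hxz ▸ hxb
  by_cases hyz : y = z
  · exact hyz ▸ hyb
  obtain ⟨b', hb', hx', hy', hz'⟩ := hB.triangle x y z hxy hyz hxz (adj x hx y hy hxy).2
    (adj y hy z hz hyz).2 (adj x hx z hz hxz).2
  rwa [hB.linear b hb b' hb' x hxb y hyb hx' hy' hxy]

theorem exists_copyVerts_subset (ht : 3 ≤ t) (hB : IsCliqueSystem (t + 1) B)
    (H : copies (SimpleGraph.completeGraph (Fin t)) (blockGraph B)) :
    ∃ b ∈ B, copyVerts H ⊆ b := by
  have hc : 1 < (copyVerts H).card := by rw [card_copyVerts]; omega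
  obtain ⟨x, hx, y, hy, hxy⟩ := Finset.one_lt_card.1 hc
  obtain ⟨-, b, hb, hxb, hyb⟩ :=
    (adj_of_mem_copies H.2 (mem_copyVerts.1 hx) (mem_copyVerts.1 hy) hxy).adj_sub
  exact ⟨b, hb, hB.copyVerts_subset H hb hxy hx hy hxb hyb⟩

theorem packingNumber_le (ht : 3 ≤ t) (hB : IsCliqueSystem (t + 1) B) :
    packingNumber (SimpleGraph.completeGraph (Fin t)) (blockGraph B) ≤ B.card := by
  classical
  obtain ⟨P, hP, hcard⟩ :=
    (isGreatest_packingNumber (SimpleGraph.completeGraph (Fin t)) (blockGraph B)).1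
  rw [← hcard]
  choose f hfB hf using fun H => hB.exists_copyVerts_subset ht H
  refine Finset.card_le_card_of_injOn f (fun H _ => hfB H) ?_
  intro H hH K hK hHK
  by_contra hne
  have h1 := hf H
  have h2 := hf K
  rw [← show f H = f K from hHK] at h2
  have h3 := Finset.card_le_card (Finset.union_subset h1 h2)
  have h4 := Finset.card_union_add_card_inter (copyVerts H) (copyVerts K)
  rw [hB.card_eq _ (hfB H)] at h3
  rw [card_copyVerts, card_copyVerts] at h4
  -- Two t-subsets of a (t+1)-set meet in at least t-1 ≥ 2 points, so the copies share an edge.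
  obtain ⟨x, hx, y, hy, hxy⟩ :=
    Finset.one_lt_card.1 (show 1 < (copyVerts H ∩ copyVerts K).card by omega)
  rw [Finset.mem_inter, mem_copyVerts, mem_copyVerts] at hx hy
  exact Set.disjoint_left.1 (hP H hH K hK hne)
    (SimpleGraph.Subgraph.mem_edgeSet.2 (adj_of_mem_copies H.2 hx.1 hy.1 hxy))
    (SimpleGraph.Subgraph.mem_edgeSet.2 (adj_of_mem_copies K.2 hx.2 hy.2 hxy))

-- A copy through the edge xy is its block minus one vertex other than x and y, which leaves t-1
-- choices. This is why the uniform weight 1/(t-1) is admissible.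
open Classical in
theorem card_copies_mem_edge_le (hB : IsCliqueSystem (t + 1) B) {e : Sym2 V}
    (he : e ∈ (blockGraph B).edgeSet) :
    (Finset.univ.filter fun H : copies (SimpleGraph.completeGraph (Fin t)) (blockGraph B) =>
      e ∈ H.1.edgeSet).card ≤ t - 1 := by
  induction e using Sym2.ind with
  | _ x y =>
  obtain ⟨hxy, b, hb, hx, hy⟩ := SimpleGraph.mem_edgeSet _ |>.1 he
  have hcard : (b \ {x, y}).card = t - 1 := by
    rw [Finset.card_sdiff_of_subset (by simp [Finset.insert_subset_iff, hx, hy]),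
      Finset.card_pair hxy, hB.card_eq b hb]
    omega
  rw [← hcard, ← Finset.card_image_of_injective _ copyVerts_injective]
  refine (Finset.card_le_card ?_).trans
    (Finset.card_image_le (s := b \ {x, y}) (f := fun z => b.erase z))
  intro s hs
  obtain ⟨H, hH, rfl⟩ := Finset.mem_image.1 hs
  have hadj := SimpleGraph.Subgraph.mem_edgeSet.1 (Finset.mem_filter.1 hH).2
  have hxH := mem_copyVerts.2 (H.1.edge_vert hadj)
  have hyH := mem_copyVerts.2 (H.1.edge_vert hadj.symm)
  have hsub := hB.copyVerts_subset H hb hxy hxH hyH hx hy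
  have hone : (b \ copyVerts H).card = 1 := by
    rw [Finset.card_sdiff_of_subset hsub, hB.card_eq b hb, card_copyVerts]
    omega
  obtain ⟨z, hz⟩ := Finset.card_eq_one.1 hone
  have hzm : z ∈ b \ copyVerts H := by simp [hz]
  rw [Finset.mem_sdiff] at hzm
  refine Finset.mem_image.2 ⟨z, ?_, ?_⟩
  · rw [Finset.mem_sdiff, Finset.mem_insert, Finset.mem_singleton]
    refine ⟨hzm.1, ?_⟩
    rintro (rfl | rfl)
    · exact hzm.2 hxH
    · exact hzm.2 hyH
  · rw [Finset.erase_eq, ← hz, Finset.sdiff_sdiff_eq_self hsub]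

theorem card_mul_le_card_copies (ht : 3 ≤ t) (hB : IsCliqueSystem (t + 1) B) :
    B.card * (t + 1) ≤
      Fintype.card (copies (SimpleGraph.completeGraph (Fin t)) (blockGraph B)) := by
  classical
  have hle : ∀ b ∈ B, ∀ z ∈ b, (b.erase z).card = t := fun b hb z hz => by
    rw [Finset.card_erase_of_mem hz, hB.card_eq b hb, Nat.add_sub_cancel]
  rw [← Finset.card_univ, ← Finset.card_image_of_injective _ copyVerts_injective,
    ← show (B.sigma fun b => b).card = B.card * (t + 1) by
      rw [Finset.card_sigma, Finset.sum_const_nat hB.card_eq]]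
  refine Finset.card_le_card_of_injOn (fun p => p.1.erase p.2) ?_ ?_
  · rintro ⟨b, z⟩ hp
    obtain ⟨hb, hz⟩ := Finset.mem_sigma.1 hp
    refine Finset.mem_image.2 ⟨⟨_, induce_mem_copies (hle b hb z hz) ?_⟩, Finset.mem_univ _, ?_⟩
    · intro x hx y hy hxy
      exact ⟨hxy, b, hb, Finset.mem_of_mem_erase hx, Finset.mem_of_mem_erase hy⟩
    · ext x
      rw [mem_copyVerts]
      exact Iff.rfl
  · rintro ⟨b, z⟩ hp ⟨b', z'⟩ hp' h
    obtain ⟨hb, hz⟩ := Finset.mem_sigma.1 hp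
    obtain ⟨hb', hz'⟩ := Finset.mem_sigma.1 hp'
    dsimp only at hb hz hb' hz' h
    obtain ⟨x, hx, y, hy, hxy⟩ :=
      Finset.one_lt_card.1 (show 1 < (b.erase z).card by rw [hle b hb z hz]; omega)
    have hx' := hx
    have hy' := hy
    rw [h] at hx' hy'
    obtain rfl := hB.linear b hb b' hb' x (Finset.mem_of_mem_erase hx) y
      (Finset.mem_of_mem_erase hy) (Finset.mem_of_mem_erase hx') (Finset.mem_of_mem_erase hy') hxy
    obtain rfl := (Finset.erase_inj b hz).1 h
    rfl

theorem le_fracPackingNumber (ht : 3 ≤ t) (hB : IsCliqueSystem (t + 1) B) :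
    (B.card : ℝ) * (t + 1) / (t - 1) ≤
      fracPackingNumber (SimpleGraph.completeGraph (Fin t)) (blockGraph B) := by
  classical
  have ht' : (3 : ℝ) ≤ t := by exact_mod_cast ht
  have hpos : (0 : ℝ) < t - 1 := by linarith
  have hw : IsFracPacking (SimpleGraph.completeGraph (Fin t)) (blockGraph B)
      fun _ => 1 / ((t : ℝ) - 1) := by
    refine ⟨fun H => ⟨by positivity, (div_le_one hpos).2 (by linarith)⟩, fun e he => ?_⟩
    rw [Finset.sum_const, nsmul_eq_mul, mul_one_div, div_le_one hpos]
    have h : _ ≤ t - 1 := hB.card_copies_mem_edge_le he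
    have h' : (t : ℝ) - 1 = ((t - 1 : ℕ) : ℝ) := by
      rw [Nat.cast_sub (by omega), Nat.cast_one]
    rw [h']
    convert (Nat.cast_le (α := ℝ)).2 h
  refine le_trans ?_ ((isGreatest_fracPackingNumber _ _).2 ⟨_, hw, rfl⟩)
  rw [Finset.sum_const, nsmul_eq_mul, mul_one_div, Finset.card_univ]
  gcongr
  exact_mod_cast hB.card_mul_le_card_copies ht

theorem le_packingGap (ht : 3 ≤ t) (hB : IsCliqueSystem (t + 1) B) :
    (B.card : ℝ) * (2 / (t - 1)) ≤
      packingGap (SimpleGraph.completeGraph (Fin t)) (blockGraph B) := by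
  have ht' : (3 : ℝ) ≤ t := by exact_mod_cast ht
  have hpos : (0 : ℝ) < t - 1 := by linarith
  have h1 := hB.le_fracPackingNumber ht
  have h2 : (packingNumber (SimpleGraph.completeGraph (Fin t)) (blockGraph B) : ℝ) ≤ B.card := by
    exact_mod_cast hB.packingNumber_le ht
  have h3 : (B.card : ℝ) * (2 / (t - 1)) = (B.card : ℝ) * (t + 1) / (t - 1) - B.card := by
    field_simp
    ring
  rw [packingGap, h3]
  linarith

end IsCliqueSystem

end CliqueSystems

/-! ### Clique systems from arithmetic progressions -/

section Progressions

theorem IsCliqueSystem.map {V : Type u} {V' : Type v} {k : ℕ} {B : Finset (Finset V)}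
    (hB : IsCliqueSystem k B) (f : V ↪ V') :
    IsCliqueSystem k (B.map (Finset.mapEmbedding f).toEmbedding) where
  card_eq := by
    simp only [Finset.mem_map, forall_exists_index, and_imp, forall_apply_eq_imp_iff₂]
    intro b hb
    simpa using hB.card_eq b hb
  linear := by
    simp only [Finset.mem_map, forall_exists_index, and_imp, forall_apply_eq_imp_iff₂]
    intro b hb b' hb'
    simp only [RelEmbedding.coe_toEmbedding, Finset.mapEmbedding_apply, Finset.mem_map,
      forall_exists_index, and_imp, forall_apply_eq_imp_iff₂, Finset.map_inj]
    intro x hx y hy x' hx' hxx y' hy' hyy hne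
    obtain rfl := f.injective hxx
    obtain rfl := f.injective hyy
    exact hB.linear b hb b' hb' _ hx _ hy hx' hy' fun h => hne (congrArg f h)
  triangle := by
    simp only [Finset.mem_map, RelEmbedding.coe_toEmbedding, exists_exists_and_eq_and,
      Finset.mapEmbedding_apply]
    rintro _ _ _ hxy hyz hxz ⟨b, hb, ⟨x, hx, rfl⟩, ⟨y, hy, rfl⟩⟩
      ⟨b', hb', ⟨y', hy', hyy⟩, ⟨z, hz, rfl⟩⟩
      ⟨b'', hb'', ⟨x', hx', hxx⟩, ⟨z', hz', hzz⟩⟩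
    obtain rfl := f.injective hyy
    obtain rfl := f.injective hxx
    obtain rfl := f.injective hzz
    obtain ⟨d, hd, h1, h2, h3⟩ := hB.triangle _ _ _ (fun h => hxy (congrArg f h))
      (fun h => hyz (congrArg f h)) (fun h => hxz (congrArg f h)) ⟨b, hb, hx, hy⟩
      ⟨b', hb', hy', hz⟩ ⟨b'', hb'', hx', hz'⟩
    exact ⟨d, hd, ⟨_, h1, rfl⟩, ⟨_, h2, rfl⟩, ⟨_, h3, rfl⟩⟩

variable {Γ : Type u} [AddCommGroup Γ]

/-- No element of `A` is a nontrivial convex combination of two others with small coefficients. -/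
def ConvexlyIndependent (t : ℕ) (A : Finset Γ) : Prop :=
  ∀ p q : ℕ, 0 < p → 0 < q → p + q ≤ t → ∀ a ∈ A, ∀ b ∈ A, ∀ c ∈ A,
    p • a + q • b = (p + q) • c → a = c ∧ b = c

theorem ConvexlyIndependent.nsmul_inj {t : ℕ} {A : Finset Γ} (hA : ConvexlyIndependent t A)
    {m : ℕ} (hm : 0 < m) (hmt : m ≤ t) {a b : Γ} (ha : a ∈ A) (hb : b ∈ A)
    (h : m • a = m • b) : a = b := by
  obtain rfl | hm1 : m = 1 ∨ 1 < m := by omega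
  · simpa using h
  -- Both coefficients must be positive, so m•a is split as 1•a + (m-1)•a; this is why m = 1 is
  -- separate.
  · refine (hA 1 (m - 1) one_pos (by omega) (by omega) a ha a ha b hb ?_).1
    rw [← add_nsmul, Nat.add_sub_cancel' hm, h]

variable [DecidableEq Γ]

/-- The graph of the progression `i ↦ x + i • a`. -/
def progression (t : ℕ) (x a : Γ) : Finset (Fin (t + 1) × Γ) :=
  Finset.univ.image fun i => (i, x + (i : ℕ) • a)

theorem mem_progression {t : ℕ} {x a : Γ} {v : Fin (t + 1) × Γ} :
    v ∈ progression t x a ↔ v.2 = x + (v.1 : ℕ) • a := by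
  obtain ⟨i, y⟩ := v
  simp [progression, eq_comm]

theorem card_progression {t : ℕ} {x a : Γ} : (progression t x a).card = t + 1 := by
  rw [progression, Finset.card_image_of_injective, Finset.card_univ, Fintype.card_fin]
  intro i j h
  exact congrArg Prod.fst h

theorem progression_injective {t : ℕ} (ht : 0 < t) {x a x' a' : Γ}
    (h : progression t x a = progression t x' a') : x = x' ∧ a = a' := by
  have h0 : ((⟨0, by omega⟩ : Fin (t + 1)), x) ∈ progression t x' a' := by
    rw [← h, mem_progression]
    simp
  have h1 : ((⟨1, by omega⟩ : Fin (t + 1)), x + a) ∈ progression t x' a' := by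
    rw [← h, mem_progression]
    simp
  rw [mem_progression] at h0 h1
  simp only [zero_nsmul, add_zero, one_nsmul] at h0 h1
  subst h0
  exact ⟨rfl, add_left_cancel h1⟩

theorem sub_of_mem_progression {t : ℕ} {x a : Γ} {v w : Fin (t + 1) × Γ}
    (hv : v ∈ progression t x a) (hw : w ∈ progression t x a) (h : v.1 < w.1) :
    w.2 = v.2 + ((w.1 : ℕ) - (v.1 : ℕ)) • a := by
  rw [mem_progression] at hv hw
  rw [hv, hw, add_assoc, ← add_nsmul, Nat.add_sub_cancel' (Fin.lt_def.1 h).le]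

theorem mem_progression_of_sub {t : ℕ} {x a : Γ} {v w : Fin (t + 1) × Γ}
    (hv : v ∈ progression t x a) (h : v.1 < w.1)
    (hw : w.2 = v.2 + ((w.1 : ℕ) - (v.1 : ℕ)) • a) : w ∈ progression t x a := by
  rw [mem_progression] at hv ⊢
  rw [hw, hv, add_assoc, ← add_nsmul, Nat.add_sub_cancel' (Fin.lt_def.1 h).le]

theorem fst_ne_of_mem_progression {t : ℕ} {x a : Γ} {v w : Fin (t + 1) × Γ}
    (hv : v ∈ progression t x a) (hw : w ∈ progression t x a) (h : v ≠ w) : v.1 ≠ w.1 := by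
  intro h1
  rw [mem_progression] at hv hw
  exact h (Prod.ext h1 (by rw [hv, hw, h1]))

/-- Going from u to w directly or through v yields p•a + q•b = (p+q)•c, where p and q are the index
gaps and p+q ≤ t. Hence all three differences agree. -/
theorem ConvexlyIndependent.triangle_of_lt {t : ℕ} {A : Finset Γ} (hA : ConvexlyIndependent t A)
    {u v w : Fin (t + 1) × Γ} (huv : u.1 < v.1) (hvw : v.1 < w.1)
    (h1 : ∃ x, ∃ a ∈ A, u ∈ progression t x a ∧ v ∈ progression t x a)
    (h2 : ∃ x, ∃ a ∈ A, v ∈ progression t x a ∧ w ∈ progression t x a)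
    (h3 : ∃ x, ∃ a ∈ A, u ∈ progression t x a ∧ w ∈ progression t x a) :
    ∃ x, ∃ a ∈ A, u ∈ progression t x a ∧ v ∈ progression t x a ∧ w ∈ progression t x a := by
  obtain ⟨x, a, ha, hu, hv⟩ := h1
  obtain ⟨y, b, hb, hv', hw⟩ := h2
  obtain ⟨z, c, hc, hu', hw'⟩ := h3
  have e1 := sub_of_mem_progression hu hv huv
  have e2 := sub_of_mem_progression hv' hw hvw
  have e3 := sub_of_mem_progression hu' hw' (huv.trans hvw)
  have l1 := Fin.lt_def.1 huv
  have l2 := Fin.lt_def.1 hvw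
  have l3 := w.1.2
  have hsum : ((v.1 : ℕ) - (u.1 : ℕ)) + ((w.1 : ℕ) - (v.1 : ℕ)) = (w.1 : ℕ) - (u.1 : ℕ) := by
    omega
  have key := hA ((v.1 : ℕ) - (u.1 : ℕ)) ((w.1 : ℕ) - (v.1 : ℕ)) (by omega) (by omega)
    (by omega) a ha b hb c hc (by
      rw [hsum]
      refine add_left_cancel (a := u.2) ?_
      rw [← e3, e2, e1, add_assoc])
  obtain ⟨rfl, rfl⟩ := key
  exact ⟨x, b, hb, hu, hv, mem_progression_of_sub hv hvw e2⟩

variable [Fintype Γ]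

/-- All progressions with common difference in `A`. -/
def progressions (t : ℕ) (A : Finset Γ) : Finset (Finset (Fin (t + 1) × Γ)) :=
  (Finset.univ ×ˢ A).image fun p => progression t p.1 p.2

theorem exists_mem_progressions {t : ℕ} {A : Finset Γ}
    {P : Finset (Fin (t + 1) × Γ) → Prop} :
    (∃ b ∈ progressions t A, P b) ↔ ∃ x, ∃ a ∈ A, P (progression t x a) := by
  simp [progressions]

theorem card_progressions {t : ℕ} (ht : 0 < t) (A : Finset Γ) :
    (progressions t A).card = Fintype.card Γ * A.card := by
  rw [progressions, Finset.card_image_of_injective, Finset.card_product, Finset.card_univ]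
  rintro ⟨x, a⟩ ⟨x', a'⟩ h
  obtain ⟨rfl, rfl⟩ := progression_injective ht h
  rfl

theorem ConvexlyIndependent.isCliqueSystem {t : ℕ} {A : Finset Γ}
    (hA : ConvexlyIndependent t A) : IsCliqueSystem (t + 1) (progressions t A) where
  card_eq := by
    intro b hb
    obtain ⟨p, -, rfl⟩ := Finset.mem_image.1 hb
    exact card_progression
  linear := by
    intro b hb b' hb' v hv w hw hv' hw' hvw
    obtain ⟨⟨x, a⟩, ha, rfl⟩ := Finset.mem_image.1 hb
    obtain ⟨⟨x', a'⟩, ha', rfl⟩ := Finset.mem_image.1 hb'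
    replace ha : a ∈ A := (Finset.mem_product.1 ha).2
    replace ha' : a' ∈ A := (Finset.mem_product.1 ha').2
    dsimp only at hv hw hv' hw' ⊢
    have key : ∀ v w : Fin (t + 1) × Γ, v.1 < w.1 → v ∈ progression t x a →
        w ∈ progression t x a → v ∈ progression t x' a' → w ∈ progression t x' a' →
        a = a' := by
      intro v w hlt hv hw hv' hw'
      have e := sub_of_mem_progression hv hw hlt
      rw [sub_of_mem_progression hv' hw' hlt] at e
      have := Fin.lt_def.1 hlt
      have := w.1.2
      exact hA.nsmul_inj (by omega) (by omega) ha ha' (add_left_cancel e).symm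
    obtain rfl : a = a' := by
      rcases lt_or_gt_of_ne (fst_ne_of_mem_progression hv hw hvw) with h | h
      · exact key v w h hv hw hv' hw'
      · exact key w v h hw hv hw' hv'
    rw [mem_progression] at hv hv'
    rw [hv] at hv'
    rw [add_right_cancel hv']
  triangle := by
    intro u v w huv hvw huw h1 h2 h3
    rw [exists_mem_progressions] at h1 h2 h3 ⊢
    have n1 : u.1 ≠ v.1 := by
      obtain ⟨x, a, -, h, h'⟩ := h1
      exact fst_ne_of_mem_progression h h' huv
    have n2 : v.1 ≠ w.1 := by
      obtain ⟨x, a, -, h, h'⟩ := h2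
      exact fst_ne_of_mem_progression h h' hvw
    have n3 : u.1 ≠ w.1 := by
      obtain ⟨x, a, -, h, h'⟩ := h3
      exact fst_ne_of_mem_progression h h' huw
    have h1' : ∃ x, ∃ a ∈ A, v ∈ progression t x a ∧ u ∈ progression t x a := by
      simpa only [and_comm] using h1
    have h2' : ∃ x, ∃ a ∈ A, w ∈ progression t x a ∧ v ∈ progression t x a := by
      simpa only [and_comm] using h2
    have h3' : ∃ x, ∃ a ∈ A, w ∈ progression t x a ∧ u ∈ progression t x a := by
      simpa only [and_comm] using h3
    -- Of the eight sign patterns, six are orderings of the indices and two are cyclic, hence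
    -- impossible.
    rcases lt_or_gt_of_ne n1 with l1 | l1 <;> rcases lt_or_gt_of_ne n2 with l2 | l2 <;>
      rcases lt_or_gt_of_ne n3 with l3 | l3
    · have := hA.triangle_of_lt l1 l2 h1 h2 h3
      tauto
    · exact absurd (l1.trans l2) l3.asymm
    · obtain ⟨x, a, ha, p, q, r⟩ := hA.triangle_of_lt l3 l2 h3 h2' h1
      exact ⟨x, a, ha, p, r, q⟩
    · obtain ⟨x, a, ha, p, q, r⟩ := hA.triangle_of_lt l3 l1 h3' h1 h2'
      exact ⟨x, a, ha, q, r, p⟩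
    · obtain ⟨x, a, ha, p, q, r⟩ := hA.triangle_of_lt l1 l3 h1' h3 h2
      exact ⟨x, a, ha, q, p, r⟩
    · obtain ⟨x, a, ha, p, q, r⟩ := hA.triangle_of_lt l2 l3 h2 h3' h1'
      exact ⟨x, a, ha, r, p, q⟩
    · exact absurd (l2.trans l1) l3.asymm
    · obtain ⟨x, a, ha, p, q, r⟩ := hA.triangle_of_lt l2 l1 h2' h1' h3'
      exact ⟨x, a, ha, r, q, p⟩

end Progressions

/-! ### A Behrend-type set on a paraboloid -/

section Paraboloid

theorem natCast_inj_of_lt {m a b : ℕ} (ha : a < m) (hb : b < m)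
    (h : (a : ZMod m) = b) : a = b := by
  rwa [ZMod.natCast_eq_natCast_iff', Nat.mod_eq_of_lt ha, Nat.mod_eq_of_lt hb] at h

/-- The lift of a point of the box `[0, L) ^ D` to the paraboloid, with wide enough moduli. -/
def paraboloid (t D L : ℕ) (b : Fin D → Fin L) :
    (Fin D → ZMod (t * L)) × ZMod (t * D * L ^ 2) :=
  (fun i => ((b i : ℕ) : ZMod (t * L)), ((∑ i, (b i : ℕ) ^ 2 : ℕ) : ZMod (t * D * L ^ 2)))

theorem paraboloid_injective {t D L : ℕ} (ht : 0 < t) :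
    Function.Injective (paraboloid t D L) := by
  intro b c h
  ext i
  have hi := congrFun (congrArg Prod.fst h) i
  have hL : L ≤ t * L := Nat.le_mul_of_pos_left L ht
  exact natCast_inj_of_lt ((b i).2.trans_le hL) ((c i).2.trans_le hL) hi

/-- Strict convexity of the squared norm: the hypotheses make p|a-c|² + q|b-c|² vanish. -/
theorem eq_of_convex_combination {D : ℕ} {p q : ℤ} (hp : 0 < p) (hq : 0 < q) {a b c : Fin D → ℤ}
    (h : ∀ i, p * a i + q * b i = (p + q) * c i)
    (hs : p * ∑ i, a i ^ 2 + q * ∑ i, b i ^ 2 = (p + q) * ∑ i, c i ^ 2) : a = c ∧ b = c := by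
  have key : ∑ i, (p * (a i - c i) ^ 2 + q * (b i - c i) ^ 2) = 0 := by
    have e : ∀ i, p * (a i - c i) ^ 2 + q * (b i - c i) ^ 2 =
        p * a i ^ 2 + q * b i ^ 2 - (p + q) * c i ^ 2 := fun i => by
      linear_combination (-2 * c i) * h i
    simp only [e, Finset.sum_sub_distrib, Finset.sum_add_distrib, ← Finset.mul_sum]
    linarith
  rw [Finset.sum_eq_zero_iff_of_nonneg fun i _ => by positivity] at key
  constructor <;> ext i
  · have := key i (Finset.mem_univ i)
    have h1 : p * (a i - c i) ^ 2 = 0 := by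
      nlinarith [mul_nonneg hp.le (sq_nonneg (a i - c i)),
        mul_nonneg hq.le (sq_nonneg (b i - c i))]
    have h2 := (mul_eq_zero.1 h1).resolve_left hp.ne'
    exact sub_eq_zero.1 (pow_eq_zero_iff two_ne_zero |>.1 h2)
  · have := key i (Finset.mem_univ i)
    have h1 : q * (b i - c i) ^ 2 = 0 := by
      nlinarith [mul_nonneg hp.le (sq_nonneg (a i - c i)),
        mul_nonneg hq.le (sq_nonneg (b i - c i))]
    have h2 := (mul_eq_zero.1 h1).resolve_left hq.ne'
    exact sub_eq_zero.1 (pow_eq_zero_iff two_ne_zero |>.1 h2)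

theorem convexlyIndependent_paraboloid {t D L : ℕ} (hD : 0 < D) :
    ConvexlyIndependent t (Finset.univ.image (paraboloid t D L)) := by
  intro p q hp hq hpq a' ha' b' hb' c' hc' h
  obtain ⟨a, -, rfl⟩ := Finset.mem_image.1 ha'
  obtain ⟨b, -, rfl⟩ := Finset.mem_image.1 hb'
  obtain ⟨c, -, rfl⟩ := Finset.mem_image.1 hc'
  have hL : 0 < L := (Nat.zero_le _).trans_lt (a ⟨0, hD⟩).2
  -- The factor t in each modulus prevents wrap-around, so the congruences below lift to equalities
  -- of integers.
  have mix : ∀ m x y : ℕ, x < m → y < m → p * x + q * y < t * m := by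
    intro m x y hx hy
    calc p * x + q * y < p * m + q * m :=
          add_lt_add (Nat.mul_lt_mul_of_pos_left hx hp) (Nat.mul_lt_mul_of_pos_left hy hq)
      _ = (p + q) * m := by ring
      _ ≤ t * m := Nat.mul_le_mul_right m hpq
  have sq_lt : ∀ x : Fin D → Fin L, ∑ i, (x i : ℕ) ^ 2 < D * L ^ 2 := by
    intro x
    calc ∑ i, (x i : ℕ) ^ 2 < ∑ _i : Fin D, L ^ 2 :=
          Finset.sum_lt_sum_of_nonempty ⟨⟨0, hD⟩, Finset.mem_univ _⟩
            fun i _ => Nat.pow_lt_pow_left (x i).2 two_ne_zero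
      _ = D * L ^ 2 := by simp
  have h1 : ∀ i, p * (a i : ℕ) + q * (b i : ℕ) = (p + q) * (c i : ℕ) := by
    intro i
    refine natCast_inj_of_lt (m := t * L) (mix L _ _ (a i).2 (b i).2) ?_ ?_
    · rw [add_mul]
      exact mix L _ _ (c i).2 (c i).2
    · have := congrFun (congrArg Prod.fst h) i
      simpa [paraboloid, nsmul_eq_mul] using this
  have h2 : p * ∑ i, (a i : ℕ) ^ 2 + q * ∑ i, (b i : ℕ) ^ 2 = (p + q) * ∑ i, (c i : ℕ) ^ 2 := by
    refine natCast_inj_of_lt (m := t * D * L ^ 2) ?_ ?_ ?_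
    · rw [mul_assoc]
      exact mix _ _ _ (sq_lt a) (sq_lt b)
    · rw [add_mul, mul_assoc]
      exact mix _ _ _ (sq_lt c) (sq_lt c)
    · have := congrArg Prod.snd h
      simpa [paraboloid, nsmul_eq_mul] using this
  have key := eq_of_convex_combination (p := p) (q := q) (by exact_mod_cast hp)
    (by exact_mod_cast hq) (a := fun i => ((a i : ℕ) : ℤ)) (b := fun i => ((b i : ℕ) : ℤ))
    (c := fun i => ((c i : ℕ) : ℤ)) (fun i => by exact_mod_cast h1 i) (by exact_mod_cast h2)
  constructor
  · congr 1
    ext i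
    exact_mod_cast congrFun key.1 i
  · congr 1
    ext i
    exact_mod_cast congrFun key.2 i

/-- A dense clique system, embedded in any large enough vertex set. -/
theorem exists_isCliqueSystem {t D L n : ℕ} (ht : 0 < t) (hD : 0 < D) (hL : 0 < L)
    (hn : (t + 1) * ((t * L) ^ D * (t * D * L ^ 2)) ≤ n) :
    ∃ B : Finset (Finset (Fin n)), IsCliqueSystem (t + 1) B ∧
      B.card = (t * L) ^ D * (t * D * L ^ 2) * L ^ D := by
  have : NeZero (t * L) := ⟨by positivity⟩
  have : NeZero (t * D * L ^ 2) := ⟨by positivity⟩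
  have hcard : Fintype.card ((Fin D → ZMod (t * L)) × ZMod (t * D * L ^ 2)) =
      (t * L) ^ D * (t * D * L ^ 2) := by
    simp [ZMod.card]
  obtain ⟨f⟩ : Nonempty ((Fin (t + 1) × ((Fin D → ZMod (t * L)) × ZMod (t * D * L ^ 2))) ↪
      Fin n) := by
    refine Function.Embedding.nonempty_of_card_le ?_
    rwa [Fintype.card_prod, hcard, Fintype.card_fin, Fintype.card_fin]
  refine ⟨_, (convexlyIndependent_paraboloid (L := L) hD).isCliqueSystem.map f, ?_⟩
  rw [Finset.card_map, card_progressions ht, hcard,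
    Finset.card_image_of_injective _ (paraboloid_injective ht)]
  simp

end Paraboloid

/-! ### Choice of parameters and asymptotics -/

section Asymptotics

open Filter

theorem exists_max_mul_pow_le {M k : ℕ} (hM : 0 < M) (hk : 0 < k) (n : ℕ) :
    ∃ L, M * L ^ k ≤ n ∧ n < M * (L + 1) ^ k := by
  classical
  have hex : ∃ L, n < M * L ^ k :=
    ⟨n + 1, (Nat.lt_succ_self n).trans_le
      ((Nat.le_self_pow hk.ne' _).trans (Nat.le_mul_of_pos_left _ hM))⟩
  have hpos : Nat.find hex ≠ 0 := by
    intro h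
    have := Nat.find_spec hex
    rw [h, zero_pow hk.ne'] at this
    omega
  obtain ⟨L, hL⟩ := Nat.exists_eq_succ_of_ne_zero hpos
  exact ⟨L, not_lt.1 (Nat.find_min hex (by omega)), by
    have := Nat.find_spec hex
    rwa [hL] at this⟩

/-- Rounding s up costs at most one factor x. It serves to absorb exponentials in the dimension into
powers of (log n)^s. -/
theorem pow_natCeil_le {x y s : ℝ} (hx : 1 ≤ x) (hy : 0 < y) (hs : 0 ≤ s) {k : ℕ}
    (hxy : x ≤ y ^ k) : x ^ ⌈s⌉₊ ≤ x * (y ^ s) ^ k := by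
  have hx0 : 0 < x := zero_lt_one.trans_le hx
  calc x ^ ⌈s⌉₊ = x ^ (⌈s⌉₊ : ℝ) := (Real.rpow_natCast _ _).symm
    _ ≤ x ^ (1 + s) :=
      Real.rpow_le_rpow_of_exponent_le hx (by linarith [Nat.ceil_lt_add_one hs])
    _ = x * x ^ s := by rw [Real.rpow_add hx0, Real.rpow_one]
    _ ≤ x * (y ^ k) ^ s := by gcongr
    _ = x * (y ^ s) ^ k := by
      rw [← Real.rpow_natCast, ← Real.rpow_natCast, ← Real.rpow_mul hy.le, ← Real.rpow_mul hy.le,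
        mul_comm s]

theorem exists_large_isCliqueSystem {t n : ℕ} (ht : 3 ≤ t)
    (hn : Real.exp ((t : ℝ) + 1) ≤ n) :
    ∃ B : Finset (Finset (Fin n)), IsCliqueSystem (t + 1) B ∧
      (n : ℝ) ^ 2 ≤ 128 * t ^ 4 * (t + 1) ^ 2 * B.card *
        Real.log n ^ (8 * Real.sqrt (Real.log n / Real.log (Real.log n))) := by
  have ht' : (3 : ℝ) ≤ t := by exact_mod_cast ht
  have hn0 : (0 : ℝ) < n := (Real.exp_pos _).trans_le hn
  have hlog : (t : ℝ) + 1 ≤ Real.log n := (Real.le_log_iff_exp_le hn0).2 hn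
  have htn : t + 1 ≤ n := by
    have := Real.add_one_le_exp ((t : ℝ) + 1)
    have h : ((t + 1 : ℕ) : ℝ) ≤ n := by push_cast; linarith
    exact_mod_cast h
  set l := Real.log n with hl
  have hl4 : 4 ≤ l := by linarith
  have hl0 : 0 < l := by linarith
  have hll : 0 < Real.log l := Real.log_pos (by linarith)
  set s := Real.sqrt (l / Real.log l) with hs
  have hs0 : 0 < s := Real.sqrt_pos.2 (by positivity)
  have hss : s * s * Real.log l = l := by
    rw [hs, Real.mul_self_sqrt (by positivity)]
    field_simp
  -- Y is the unit of loss: Y^s = n, and the target factor is Y^8. The dimension is ⌈s⌉.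
  set Y := l ^ s with hY
  have hY1 : 1 ≤ Y := Real.one_le_rpow (by linarith) hs0.le
  have hYs : Y ^ s = n := by
    rw [hY, ← Real.rpow_mul hl0.le, Real.rpow_def_of_pos hl0, mul_comm, hss, hl,
      Real.exp_log hn0]
  have hT : l ^ (8 * s) = Y ^ 8 := by
    rw [mul_comm, Real.rpow_mul hl0.le]
    exact_mod_cast Real.rpow_natCast (l ^ s) 8
  rw [hT]
  have hD0 : 0 < ⌈s⌉₊ := Nat.ceil_pos.2 hs0
  have hDs : s ≤ ⌈s⌉₊ := Nat.le_ceil s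
  -- For L > 0, the ratio n²/|B| carries (4t)^D · D · L² up to constants. With D ≤ 2^D this is
  -- (8t)^D · L²; the exponent 6 leaves Y² for L².
  have h8 : (8 * t : ℝ) ^ ⌈s⌉₊ ≤ 8 * t * Y ^ 6 := by
    refine pow_natCeil_le (by linarith) hl0 hs0.le ?_
    calc (8 * t : ℝ) ≤ 4 ^ 5 * l := by linarith
      _ ≤ l ^ 5 * l := by gcongr
      _ = l ^ 6 := by ring
  have h4 : (4 * t ^ 2 : ℝ) ^ ⌈s⌉₊ ≤ 4 * t ^ 2 * Y ^ 8 := by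
    refine pow_natCeil_le (by nlinarith) hl0 hs0.le ?_
    calc (4 * t ^ 2 : ℝ) ≤ 4 ^ 6 * l ^ 2 := by
          have : (t : ℝ) ^ 2 ≤ l ^ 2 := by gcongr; linarith
          nlinarith [sq_nonneg l]
      _ ≤ l ^ 6 * l ^ 2 := by gcongr
      _ = l ^ 8 := by ring
  set D := ⌈s⌉₊ with hD
  have hD2 : (D : ℝ) ≤ 2 ^ D := by exact_mod_cast (Nat.lt_two_pow_self (n := D)).le
  obtain ⟨L, hL, hL'⟩ := exists_max_mul_pow_le (M := (t + 1) * t ^ (D + 1) * D) (k := D + 2)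
    (by positivity) (by positivity) n
  have hLr : (n : ℝ) ≤ (t + 1) * t ^ (D + 1) * D * (L + 1) ^ (D + 2) := by exact_mod_cast hL'.le
  -- If not even L = 1 fits, n is so small that a single block suffices.
  rcases Nat.eq_zero_or_pos L with rfl | hL0
  · obtain ⟨S, -, hS⟩ := Finset.exists_subset_card_eq
      (s := (Finset.univ : Finset (Fin n))) (n := t + 1) (by simpa using htn)
    refine ⟨{S}, hS ▸ isCliqueSystem_singleton, ?_⟩
    simp only [Nat.cast_zero, zero_add, one_pow, mul_one, Finset.card_singleton,
      Nat.cast_one] at hLr ⊢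
    calc (n : ℝ) ^ 2 ≤ (((t + 1) * t ^ (D + 1) * D) ^ 2 : ℝ) := by gcongr
      _ ≤ (((t + 1) * t ^ (D + 1) * 2 ^ D) ^ 2 : ℝ) := by gcongr
      _ = ((t + 1) ^ 2 * t ^ 2 * (4 * t ^ 2) ^ D : ℝ) := by
        rw [mul_pow 4, ← pow_mul, show (4 : ℝ) = 2 ^ 2 by norm_num, ← pow_mul]
        ring
      _ ≤ ((t + 1) ^ 2 * t ^ 2 * (4 * t ^ 2 * Y ^ 8) : ℝ) := by gcongr
      _ = (4 * t ^ 4 * (t + 1) ^ 2 * Y ^ 8 : ℝ) := by ring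
      _ ≤ (128 * t ^ 4 * (t + 1) ^ 2 * Y ^ 8 : ℝ) := by gcongr; norm_num
  · obtain ⟨B, hB, hcard⟩ := exists_isCliqueSystem (t := t) (D := D) (L := L) (n := n)
      (by omega) hD0 hL0 (by
        refine le_trans (le_of_eq ?_) hL
        ring)
    refine ⟨B, hB, ?_⟩
    have hLr0 : (1 : ℝ) ≤ L := by exact_mod_cast hL0
    have hLY : (L : ℝ) ≤ Y := by
      refine le_of_pow_le_pow_left₀ (n := D + 2) (by omega) (by linarith) ?_
      calc (L : ℝ) ^ (D + 2) ≤ n := by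
            exact_mod_cast (Nat.le_mul_of_pos_left _ (by positivity)).trans hL
        _ = Y ^ s := hYs.symm
        _ ≤ Y ^ ((D + 2 : ℕ) : ℝ) :=
          Real.rpow_le_rpow_of_exponent_le hY1 (by push_cast; linarith)
        _ = Y ^ (D + 2) := Real.rpow_natCast _ _
    have hcr : (B.card : ℝ) = (t * L) ^ D * (t * D * L ^ 2) * L ^ D := by exact_mod_cast hcard
    calc (n : ℝ) ^ 2 ≤ (((t + 1) * t ^ (D + 1) * D * (L + 1) ^ (D + 2)) ^ 2 : ℝ) := by gcongr
      _ ≤ (((t + 1) * t ^ (D + 1) * D * (2 * L) ^ (D + 2)) ^ 2 : ℝ) := by gcongr; linarith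
      _ = (16 * t * (t + 1) ^ 2 * (D * (4 * t) ^ D) * B.card * L ^ 2 : ℝ) := by
        rw [hcr, show (4 : ℝ) = 2 ^ 2 by norm_num, mul_pow (2 ^ 2), ← pow_mul]
        ring
      _ ≤ (16 * t * (t + 1) ^ 2 * (2 ^ D * (4 * t) ^ D) * B.card * Y ^ 2 : ℝ) := by gcongr
      _ = (16 * t * (t + 1) ^ 2 * (8 * t) ^ D * B.card * Y ^ 2 : ℝ) := by
        rw [← mul_pow, ← mul_assoc]
        norm_num
      _ ≤ (16 * t * (t + 1) ^ 2 * (8 * t * Y ^ 6) * B.card * Y ^ 2 : ℝ) := by gcongr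
      _ = (128 * t ^ 2 * (t + 1) ^ 2 * B.card * Y ^ 8 : ℝ) := by ring
      _ ≤ (128 * t ^ 4 * (t + 1) ^ 2 * B.card * Y ^ 8 : ℝ) := by
        gcongr
        · linarith
        · norm_num

theorem exists_packingGap_gt {t : ℕ} (ht : 3 ≤ t) : ∃ c : ℝ, 0 < c ∧ ∀ n : ℕ,
    Real.exp ((t : ℝ) + 1) ≤ (n : ℝ) → ∃ G : SimpleGraph (Fin n),
      packingGap (SimpleGraph.completeGraph (Fin t)) G > c * (n : ℝ) ^ 2 /
        Real.log n ^ (8 * Real.sqrt (Real.log n / Real.log (Real.log n))) := by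
  have ht' : (3 : ℝ) ≤ t := by exact_mod_cast ht
  have hpos : (0 : ℝ) < t - 1 := by linarith
  have hC : (0 : ℝ) < 128 * t ^ 4 * (t + 1) ^ 2 := by positivity
  -- Using 1/(t-1) in place of the available 2/(t-1) makes the inequality strict.
  refine ⟨1 / (128 * t ^ 4 * (t + 1) ^ 2) * (1 / (t - 1)), by positivity, fun n hn => ?_⟩
  obtain ⟨B, hB, hle⟩ := exists_large_isCliqueSystem ht hn
  refine ⟨blockGraph B, lt_of_lt_of_le ?_ (hB.le_packingGap ht)⟩
  have hn0 : (0 : ℝ) < n := (Real.exp_pos _).trans_le hn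
  have hlog : (t : ℝ) + 1 ≤ Real.log n := (Real.le_log_iff_exp_le hn0).2 hn
  have hT : 0 < Real.log n ^ (8 * Real.sqrt (Real.log n / Real.log (Real.log n))) :=
    Real.rpow_pos_of_pos (by linarith) _
  set T := Real.log n ^ (8 * Real.sqrt (Real.log n / Real.log (Real.log n)))
  have hB0 : (0 : ℝ) < B.card := by
    rcases (Nat.cast_nonneg (α := ℝ) B.card).eq_or_lt with h | h
    · rw [← h, mul_zero, zero_mul] at hle
      nlinarith
    · exact h
  calc 1 / (128 * t ^ 4 * (t + 1) ^ 2) * (1 / ((t : ℝ) - 1)) * (n : ℝ) ^ 2 / T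
      ≤ 1 / (128 * t ^ 4 * (t + 1) ^ 2) * (1 / ((t : ℝ) - 1)) *
        (128 * t ^ 4 * (t + 1) ^ 2 * B.card * T) / T := by gcongr
    _ = B.card * (1 / ((t : ℝ) - 1)) := by field_simp
    _ < B.card * (2 / ((t : ℝ) - 1)) := by gcongr; norm_num

theorem eventually_rpow_lt_div {c ε : ℝ} (hc : 0 < c) (hε : 0 < ε) :
    ∀ᶠ n : ℕ in atTop, (n : ℝ) ^ (2 - ε) < c * (n : ℝ) ^ 2 /
      Real.log n ^ (8 * Real.sqrt (Real.log n / Real.log (Real.log n))) := by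
  have hlog : Tendsto (fun n : ℕ => Real.log (n : ℝ)) atTop atTop :=
    Real.tendsto_log_atTop.comp tendsto_natCast_atTop_atTop
  -- With this constant the denominator is at most n^(ε/2); the other n^(ε/2) outweighs c, by `h2`.
  have h1 := hlog.eventually (Real.isLittleO_log_id_atTop.bound
    (show (0 : ℝ) < (ε / 16) ^ 2 by positivity))
  have h2 := hlog.eventually_gt_atTop (-Real.log c * 2 / ε)
  filter_upwards [h1, h2, hlog.eventually_gt_atTop 1, eventually_gt_atTop 0] with n h1 h2 h3 hn
  have hn0 : (0 : ℝ) < n := by exact_mod_cast hn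
  set l := Real.log n with hl
  have hl0 : 0 < l := by linarith
  have hll : 0 < Real.log l := Real.log_pos h3
  rw [id, Real.norm_of_nonneg hll.le, Real.norm_of_nonneg hl0.le] at h1
  have hs : Real.log l * Real.sqrt (l / Real.log l) ≤ ε / 16 * l := by
    refine abs_le_of_sq_le_sq' ?_ (by positivity) |>.2
    rw [mul_pow, Real.sq_sqrt (by positivity), mul_pow]
    calc Real.log l ^ 2 * (l / Real.log l) = Real.log l * l := by field_simp
      _ ≤ (ε / 16) ^ 2 * l * l := by gcongr
      _ = (ε / 16) ^ 2 * l ^ 2 := by ring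
  rw [lt_div_iff₀ (Real.rpow_pos_of_pos hl0 _), Real.rpow_def_of_pos hl0,
    Real.rpow_def_of_pos hn0, ← Real.exp_add, ← hl]
  have h5 : c * (n : ℝ) ^ 2 = Real.exp (Real.log c + 2 * l) := by
    rw [Real.exp_add, Real.exp_log hc, two_mul, Real.exp_add, hl, Real.exp_log hn0, sq]
  rw [h5, Real.exp_lt_exp]
  rw [div_lt_iff₀ hε] at h2
  nlinarith

theorem exists_packingGap_gt_rpow {t : ℕ} (ht : 3 ≤ t) {ε : ℝ} (hε : 0 < ε) :
    ∃ N : ℕ, ∀ n : ℕ, N < n → ∃ G : SimpleGraph (Fin n),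
      packingGap (SimpleGraph.completeGraph (Fin t)) G > (n : ℝ) ^ (2 - ε) := by
  obtain ⟨c, hc, h⟩ := exists_packingGap_gt ht
  obtain ⟨N, hN⟩ := eventually_atTop.1 ((eventually_rpow_lt_div hc hε).and
    (tendsto_natCast_atTop_atTop.eventually_ge_atTop (Real.exp ((t : ℝ) + 1))))
  refine ⟨N, fun n hn => ?_⟩
  obtain ⟨h1, h2⟩ := hN n hn.le
  obtain ⟨G, hG⟩ := h n h2
  exact ⟨G, h1.trans hG⟩

theorem not_packingGap_le_rpow : ¬ ∃ C : ℝ, ∀ n : ℕ, ∀ G : SimpleGraph (Fin n),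
    packingGap (SimpleGraph.completeGraph (Fin 3)) G ≤ C * (n : ℝ) ^ ((3 : ℝ) / 2) := by
  rintro ⟨C, hC⟩
  -- Any ε < 1/2 would do, since only 2 - ε > 3/2 matters.
  obtain ⟨N, hN⟩ := exists_packingGap_gt_rpow le_rfl (show (0 : ℝ) < 1 / 4 by norm_num)
  have h1 : Tendsto (fun n : ℕ => (n : ℝ) ^ (1 / 4 : ℝ)) atTop atTop :=
    (tendsto_rpow_atTop (by norm_num)).comp tendsto_natCast_atTop_atTop
  obtain ⟨n, hn, hnN⟩ := ((h1.eventually_ge_atTop C).and (eventually_gt_atTop N)).exists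
  obtain ⟨G, hG⟩ := hN n hnN
  have hn0 : (0 : ℝ) < n := by exact_mod_cast (Nat.zero_le N).trans_lt hnN
  refine absurd (hC n G) (not_le.2 (lt_of_le_of_lt ?_ hG))
  calc C * (n : ℝ) ^ ((3 : ℝ) / 2) ≤ (n : ℝ) ^ (1 / 4 : ℝ) * (n : ℝ) ^ ((3 : ℝ) / 2) := by gcongr
    _ = (n : ℝ) ^ (2 - 1 / 4 : ℝ) := by
      rw [← Real.rpow_add hn0]
      norm_num

end Asymptotics

end GraphPacking

theorem mainTheorem8 :
    -- the lower bound on the integrality gap, with a constant depending only on `t`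
    (∀ t : ℕ, 3 ≤ t → ∃ c : ℝ, 0 < c ∧ ∀ n : ℕ, Real.exp ((t : ℝ) + 1) ≤ (n : ℝ) →
      ∃ G : SimpleGraph (Fin n),
        GraphPacking.packingGap (SimpleGraph.completeGraph (Fin t)) G >
          c * (n : ℝ) ^ 2 /
            Real.log n ^ (8 * Real.sqrt (Real.log n / Real.log (Real.log n)))) ∧
    -- strengthening of Yuster's lower bound: every `t ≥ 3` works for every `ε`
    (∀ t : ℕ, 3 ≤ t → ∀ ε : ℝ, 0 < ε → ∃ N : ℕ, ∀ n : ℕ, N < n →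
      ∃ G : SimpleGraph (Fin n),
        GraphPacking.packingGap (SimpleGraph.completeGraph (Fin t)) G >
          (n : ℝ) ^ ((2 : ℝ) - ε)) ∧
    -- negative answer to Yuster's question: the gap for triangles is not `O(n ^ (3 / 2))`
    (¬ ∃ C : ℝ, ∀ n : ℕ, ∀ G : SimpleGraph (Fin n),
      GraphPacking.packingGap (SimpleGraph.completeGraph (Fin 3)) G ≤
        C * (n : ℝ) ^ ((3 : ℝ) / 2)) := by
  exact ⟨fun _ ht => GraphPacking.exists_packingGap_gt ht,
    fun _ ht _ hε => GraphPacking.exists_packingGap_gt_rpow ht hε,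
    GraphPacking.not_packingGap_le_rpow⟩
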